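/- **Setting.** Fix $d,E\in\mathbb N$. For every number of clients $Q$ consider one round of federated averaging. Client $k\in\{1,\dots,Q\}$ holds $N_k$ samples with differentiable losses $F_j:\mathbb R^d\to\mathbb R$ ($j\in I_k$, $|I_k|=N_k$) and has a batch size $1\le S\le N_k$; put $$F^k=\frac1{N_k}\sum_{j\in I_k}F_j,\qquad \Sigma_k(w)=\Big(\frac1S-\frac1{N_k}\Big)\frac1{N_k-1}\sum_{j\in I_k}\big(\nabla F_j(w)-\nabla F^k(w)\big)\big(\nabla F_j(w)-\nabla F^k(w)\big)^T$$ (with $\Sigma_k=0$ if $N_k=1$). All clients start the round at the same deterministic server weights $w_0^k=w_0\in\mathbb R^d$ and perform $E$ local steps $$w^k_{i+1}=w^k_i+\eta_k\,(N^k_i-G^k_i),\qquad G^k_i=\nabla F^k(w^k_i),\qquad 0\le i<E,$$ where $\eta_k$ is the learning rate of client $k$ in this round and where, conditionally on $N^k_0,\dots,N^k_{i-1}$, the gradient noise $N^k_i$ has law $\mathcal N(0,\Sigma_k(w^k_i))$. The noises of different clients are independent, and the $G^k_i$ are integrable. With weights $p_k\in\mathbb R$ the aggregated server update is $$A_T=\sum_{k=1}^Q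 p_k\sum_{i=0}^{E-1}\eta_k\,(N^k_i-G^k_i),\qquad M_T=\mathbb E[A_T],\qquad V_T=\mathrm{Cov}(A_T)=\mathbb E[A_TA_T^T]-M_TM_T^T.$$ Put $N_k=\sum_{i<E}N^k_i$ and $R_k=\sum_{i<E}(\mathbb E[G^k_i]-G^k_i)$ (random vectors in $\mathbb R^d$), with coordinates $N_{k,a},R_{k,a}$, and $x_{k,a}=p_k^2\eta_k^2\,\mathbb E[(N_{k,a}+R_{k,a})^2]$. All of this data ($p_k$, $\eta_k$, $w_0$, the clients, the probability space) may depend on $Q$. **Theorem 3.** Assume that there are constants $B$, $C>0$ and $D$, independent of $Q$, such that for all $Q$, all clients $k\le Q$ and all coordinates $a\le d$: 1. $|p_k\eta_k|\le B$; 2. $\Sigma_k(w^k_i)$ is almost surely a diagonal matrix for $0\le i<E$; 3. $\displaystyle C\le x_{k,a}^2-\frac1{2Q}\sum_{j=1}^Q\big(x_{k,a}-x_{j,a}\big)^2$; 4. for all integers $u,v\ge 0$ with $u+v=4$, the variable $N_{k,a}^uR_{k,a}^v$ is integrable and $\big|\mathbb E[N_{k,a}^uR_{k,a}^v]\big|\le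 D$. Then $A_T$ is asymptotically $\mathcal N(M_T,V_T)$ as $Q\to\infty$, in the following sense. For every $Q$ the vector $A_T$ is square integrable, and $(V_T)_{aa}>0$ for all $a$ if $Q\ge1$. Let $s_Q:\mathbb R^d\to\mathbb R^d$ be the standardization $s_Q(x)_a=(x_a-(M_T)_a)/\sqrt{(V_T)_{aa}}$. Then each coordinate of $s_Q(A_T)$ converges in distribution to $\mathcal N(0,1)$, and jointly, for every bounded continuous $f:\mathbb R^d\to\mathbb R$, $$\mathbb E\big[f(s_Q(A_T))\big]-\int f(s_Q(x))\,d\mathcal N(M_T,V_T)(x)\longrightarrow 0\qquad(Q\to\infty).$$ -/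

import Mathlib

open MeasureTheory ProbabilityTheory Filter
open scoped Topology Gradient BoundedContinuousFunction

noncomputable section

namespace FedAvg

/-- The space of model weights `ℝ^d`. -/
abbrev Weights (d : ℕ) : Type := EuclideanSpace ℝ (Fin d)

/-- A client: its finitely many samples, given through their losses, and its batch size. -/
structure Client (d : ℕ) where
  /-- the number `N_k` of samples held by the client -/
  numSamples : ℕ
  /-- the losses `F_j` of these samples -/
  sampleLoss : Fin numSamples → Weights d → ℝ
  differentiable_sampleLoss : ∀ j, Differentiable ℝ (sampleLoss j)
  /-- the size `S` of a random batch -/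
  batchSize : ℕ
  one_le_batchSize : 1 ≤ batchSize
  batchSize_le : batchSize ≤ numSamples

namespace Client

variable {d : ℕ} (c : Client d)

/-- The local objective `F^k(w) = (1 / N_k) ∑_j F_j(w)`. -/
def loss (w : Weights d) : ℝ :=
  (1 / (c.numSamples : ℝ)) * ∑ j, c.sampleLoss j w

/-- The covariance matrix of a stochastic gradient (batches drawn without replacement),
`Σ_k(w) = (1/S - 1/N_k) (1/(N_k - 1)) ∑_j (∇F_j(w) - ∇F^k(w)) (∇F_j(w) - ∇F^k(w))ᵀ`.
(If `N_k = 1` then `S = 1` and the first factor vanishes.) -/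
def gradCov (w : Weights d) : Matrix (Fin d) (Fin d) ℝ :=
  ((1 / (c.batchSize : ℝ) - 1 / (c.numSamples : ℝ)) * (1 / ((c.numSamples : ℝ) - 1))) •
    ∑ j, Matrix.vecMulVec (⇑(∇ (c.sampleLoss j) w - ∇ c.loss w))
      (⇑(∇ (c.sampleLoss j) w - ∇ c.loss w))

/-- The local SGD iterates started at `w₀` with constant learning rate `η`, driven by the
gradient noise `n`: `w_{i+1} = w_i + η (n_i - ∇F^k(w_i))`. -/
def iterate (η : ℝ) (w₀ : Weights d) (n : ℕ → Weights d) : ℕ → Weights d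
  | 0 => w₀
  | i + 1 => iterate η w₀ n i + η • (n i - ∇ c.loss (iterate η w₀ n i))

end Client

/-- The data of one communication round with `Q` clients, over a sample space `Ω`. -/
structure Round (d Q : ℕ) (Ω : Type*) where
  client : Fin Q → Client d
  /-- the aggregation weights `p_k` -/
  p : Fin Q → ℝ
  /-- the client learning rates `η_k`, constant during the round -/
  η : Fin Q → ℝ
  /-- the server weights at the beginning of the round -/
  w₀ : Weights d
  /-- `noise k i` is the gradient noise of client `k` in its local iteration `i` -/
  noise : Fin Q → ℕ → Ω → Weights d

namespace Round

variable {d Q : ℕ} {Ω : Type*} (𝓡 : Round d Q Ω)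

/-- The weights of client `k` after `i` local iterations. -/
def weights (k : Fin Q) (i : ℕ) (ω : Ω) : Weights d :=
  (𝓡.client k).iterate (𝓡.η k) 𝓡.w₀ (fun j => 𝓡.noise k j ω) i

/-- The full local gradient `G^k_i = ∇F^k(w^k_i)` at the `i`-th local iterate. -/
def grad (k : Fin Q) (i : ℕ) (ω : Ω) : Weights d :=
  ∇ (𝓡.client k).loss (𝓡.weights k i ω)

/-- The aggregated server update `A_T = ∑_k p_k ∑_{i<E} η_k (N^k_i - G^k_i)`. -/
def update (E : ℕ) (ω : Ω) : Weights d :=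
  ∑ k, 𝓡.p k • ∑ i ∈ Finset.range E, 𝓡.η k • (𝓡.noise k i ω - 𝓡.grad k i ω)

/-- `N_k = ∑_{i<E} N^k_i`. -/
def totalNoise (E : ℕ) (k : Fin Q) (ω : Ω) : Weights d :=
  ∑ i ∈ Finset.range E, 𝓡.noise k i ω

variable [MeasurableSpace Ω] (P : Measure Ω)

/-- `R_k = ∑_{i<E} (𝔼[G^k_i] - G^k_i)`. -/
def totalDev (E : ℕ) (k : Fin Q) (ω : Ω) : Weights d :=
  ∑ i ∈ Finset.range E, ((∫ ω', 𝓡.grad k i ω' ∂P) - 𝓡.grad k i ω)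

/-- The scaled second moment `p_k² η_k² 𝔼[(N_{k,a} + R_{k,a})²]` of coordinate `a`. -/
def scaledMoment (E : ℕ) (k : Fin Q) (a : Fin d) : ℝ :=
  𝓡.p k ^ 2 * 𝓡.η k ^ 2 *
    ∫ ω, (𝓡.totalNoise E k ω a + 𝓡.totalDev P E k ω a) ^ 2 ∂P

/-- The mean vector `M_T = 𝔼[A_T]`. -/
def mean (E : ℕ) : Weights d := ∫ ω, 𝓡.update E ω ∂P

/-- The covariance matrix `V_T` of `A_T`. -/
def covMatrix (E : ℕ) : Matrix (Fin d) (Fin d) ℝ :=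
  Matrix.of fun a b => cov[fun ω => 𝓡.update E ω a, fun ω => 𝓡.update E ω b; P]

/-- The affine map that centers at `M_T` and divides coordinate `a` by `√(V_T)_{aa}`. -/
def standardize (E : ℕ) (x : Weights d) : Weights d :=
  WithLp.toLp 2 fun a => (x a - 𝓡.mean P E a) / √(𝓡.covMatrix P E a a)

/-- The probabilistic model of a round with `E` local iterations: given the past of client `k`,
its `i`-th gradient noise has law `𝒩(0, Σ_k(w^k_i))`; different clients are independent; the
full gradients are integrable, so that `𝔼[G^k_i]` makes sense. -/
structure IsModel (E : ℕ) [IsProbabilityMeasure P] : Prop where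
  measurable_noise : ∀ k, ∀ i < E, Measurable (𝓡.noise k i)
  condDistrib_noise : ∀ k, ∀ i < E, ∀ᵐ ω ∂P,
    condDistrib (𝓡.noise k i) (fun ω' (j : Fin i) => 𝓡.noise k j ω') P
        (fun j : Fin i => 𝓡.noise k j ω) =
      multivariateGaussian 0 ((𝓡.client k).gradCov (𝓡.weights k i ω))
  indep : iIndepFun (fun k ω (i : Fin E) => 𝓡.noise k i ω) P
  integrable_grad : ∀ k, ∀ i < E, Integrable (𝓡.grad k i) P

end Round

end FedAvg

end

/-!
Up to its factor `p_k η_k`, client `k` contributes to `A_T - M_T` the centered update `N_k + R_k`.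
Conditionally on the past each gradient noise is a centered Gaussian, hence symmetric: flipping the
sign of the last noise preserves the joint law with the past. So integrability of the total noise
descends to its partial sums, every single noise has mean zero, and `N_k + R_k` is centered.

The updates of different clients are functions of independent noises. Comparing the characteristic
functions factor by factor, with a second-order Taylor expansion in each, bounds the distance
between those of `A_T` and of `𝒩(M_T, V_T)` at `u` by a multiple of `‖u‖³` times the sum of the
third absolute moments, which is of order `Q`. The variances of the coordinates are at least of
order `Q`, so after the standardization this bound becomes of order `Q^(-1/2)`.

The covariance matrices need not converge, but every coordinate of the standardized Gaussian has
law `𝒩(0, 1)`. These Gaussians are therefore tight, and by Prokhorov's theorem every subsequence has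
a further one along which they converge weakly; by Lévy's theorem the standardized updates then have
the same limit.
-/

namespace FedAvg

open Matrix
open scoped RealInnerProductSpace

section Lyapunov

lemma norm_exp_mul_I_sub_taylor_le (x : ℝ) :
    ‖Complex.exp (x * Complex.I) - (1 + x * Complex.I - x ^ 2 / 2)‖ ≤ 4 * |x| ^ 3 := by
  rcases le_total |x| 1 with hx | hx
  · have hxI : ‖(x : ℂ) * Complex.I‖ = |x| := by simp
    have hsum : ∑ m ∈ Finset.range 3, ((x : ℂ) * Complex.I) ^ m / m.factorial =
        1 + x * Complex.I - x ^ 2 / 2 := by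
      simp [Finset.sum_range_succ, mul_pow, Nat.factorial]
      ring
    have hexp := Complex.norm_exp_sub_sum_le_norm_mul_exp ((x : ℂ) * Complex.I) 3
    rw [hsum, hxI] at hexp
    have he : Real.exp |x| ≤ 4 := calc
      Real.exp |x| ≤ Real.exp 1 := Real.exp_le_exp.2 hx
      _ ≤ 4 := by linarith [Real.exp_one_lt_d9]
    calc _ ≤ |x| ^ 3 * Real.exp |x| := hexp
      _ ≤ |x| ^ 3 * 4 := by gcongr
      _ = 4 * |x| ^ 3 := mul_comm _ _
  · have h1 : 1 ≤ |x| ^ 3 := one_le_pow₀ hx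
    have h2 : |x| ≤ |x| ^ 3 := le_self_pow₀ hx (by norm_num)
    have h3 : |x| ^ 2 ≤ |x| ^ 3 := pow_le_pow_right₀ hx (by norm_num)
    calc _ ≤ ‖Complex.exp (x * Complex.I)‖ + (‖(1 : ℂ)‖ + ‖x * Complex.I‖ + ‖(x : ℂ) ^ 2 / 2‖) :=
          (norm_sub_le _ _).trans <| by grw [norm_sub_le, norm_add_le]
      _ = 1 + (1 + |x| + |x| ^ 2 / 2) := by simp [Complex.norm_exp_ofReal_mul_I]
      _ ≤ 4 * |x| ^ 3 := by linarith

lemma abs_exp_neg_sq_half_sub_le {s : ℝ} (hs : 0 ≤ s) :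
    |Real.exp (-(s ^ 2 / 2)) - (1 - s ^ 2 / 2)| ≤ s ^ 3 := by
  rcases le_total s 1 with h | h
  · have hle : |-(s ^ 2 / 2)| ≤ 1 := by
      rw [abs_neg, abs_of_nonneg (by positivity)]
      nlinarith
    calc _ = |Real.exp (-(s ^ 2 / 2)) - 1 - -(s ^ 2 / 2)| := by ring_nf
      _ ≤ (-(s ^ 2 / 2)) ^ 2 := Real.abs_exp_sub_one_sub_id_le hle
      _ = s ^ 3 * (s / 4) := by ring
      _ ≤ s ^ 3 := mul_le_of_le_one_right (by positivity) (by linarith)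
  · have hlow := Real.add_one_le_exp (-(s ^ 2 / 2))
    have hupp : Real.exp (-(s ^ 2 / 2)) ≤ 1 := Real.exp_le_one_iff.2 (by nlinarith)
    have hpow : s ^ 2 ≤ s ^ 3 := pow_le_pow_right₀ h (by norm_num)
    rw [abs_of_nonneg (by linarith)]
    linarith [sq_nonneg s]

lemma norm_prod_sub_prod_le {ι 𝕜 : Type*} [NormedField 𝕜] (s : Finset ι) {f g : ι → 𝕜}
    (hf : ∀ i ∈ s, ‖f i‖ ≤ 1) (hg : ∀ i ∈ s, ‖g i‖ ≤ 1) :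
    ‖∏ i ∈ s, f i - ∏ i ∈ s, g i‖ ≤ ∑ i ∈ s, ‖f i - g i‖ := by
  classical
  induction s using Finset.induction_on with
  | empty => simp
  | insert i s hi ih =>
    simp only [Finset.forall_mem_insert] at hf hg
    have hprod : ‖∏ j ∈ s, f j‖ ≤ 1 := by
      rw [norm_prod]
      exact Finset.prod_le_one (fun _ _ => norm_nonneg _) hf.2
    rw [Finset.prod_insert hi, Finset.prod_insert hi, Finset.sum_insert hi]
    calc ‖f i * ∏ j ∈ s, f j - g i * ∏ j ∈ s, g j‖
        = ‖(f i - g i) * ∏ j ∈ s, f j + g i * (∏ j ∈ s, f j - ∏ j ∈ s, g j)‖ := by ring_nf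
      _ ≤ ‖f i - g i‖ * ‖∏ j ∈ s, f j‖ + ‖g i‖ * ‖∏ j ∈ s, f j - ∏ j ∈ s, g j‖ := by
        grw [norm_add_le, norm_mul, norm_mul]
      _ ≤ ‖f i - g i‖ * 1 + 1 * ∑ j ∈ s, ‖f j - g j‖ := by
        gcongr
        exacts [hg.1, ih hf.2 hg.2]
      _ = _ := by ring

variable {Ω : Type*} [MeasurableSpace Ω] {P : Measure Ω} [IsProbabilityMeasure P]

lemma integrable_norm_pow_of_memLp {E : Type*} [NormedAddCommGroup E] {μ : Measure Ω}
    [IsFiniteMeasure μ] {X : Ω → E} {p : ENNReal} (hX : MemLp X p μ) {n : ℕ} (hn : n ≤ p) :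
    Integrable (fun ω => ‖X ω‖ ^ n) μ :=
  (hX.mono_exponent hn).integrable_norm_pow'

lemma sqrt_integral_sq_pow_three_le {Y : Ω → ℝ} (hY : MemLp Y 3 P) :
    √(∫ ω, Y ω ^ 2 ∂P) ^ 3 ≤ ∫ ω, |Y ω| ^ 3 ∂P := by
  set s := √(∫ ω, Y ω ^ 2 ∂P)
  have hs : s ^ 2 = ∫ ω, Y ω ^ 2 ∂P := Real.sq_sqrt (integral_nonneg fun _ => sq_nonneg _)
  have h3 : Integrable (fun ω => |Y ω| ^ 3) P := integrable_norm_pow_of_memLp hY le_rfl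
  have h2 : Integrable (fun ω => Y ω ^ 2) P := by
    simpa only [Real.norm_eq_abs, sq_abs] using
      integrable_norm_pow_of_memLp hY (n := 2) (by norm_num)
  -- the tangent line at `s ^ 2` of the convex function `x ↦ 2 * x ^ (3 / 2)`, taken at `x = y ^ 2`
  have htangent : ∀ y : ℝ, 3 * s * y ^ 2 - s ^ 3 ≤ 2 * |y| ^ 3 := fun y => by
    rw [← sq_abs y]
    nlinarith [mul_nonneg (sq_nonneg (|y| - s)) (by positivity : 0 ≤ 2 * |y| + s)]
  have hint : 3 * s * s ^ 2 - s ^ 3 ≤ 2 * ∫ ω, |Y ω| ^ 3 ∂P := by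
    have := integral_mono ((h2.const_mul (3 * s)).sub (integrable_const (s ^ 3)))
      (h3.const_mul 2) fun ω => htangent (Y ω)
    simpa [integral_sub (h2.const_mul (3 * s)) (integrable_const (s ^ 3)), integral_const_mul,
      ← hs] using this
  linarith

lemma norm_integral_exp_mul_I_sub_taylor_le {Y : Ω → ℝ} (hY : MemLp Y 3 P)
    (hY0 : ∫ ω, Y ω ∂P = 0) :
    ‖∫ ω, Complex.exp (Y ω * Complex.I) ∂P - (1 - (∫ ω, Y ω ^ 2 ∂P : ℝ) / 2)‖ ≤
      4 * ∫ ω, |Y ω| ^ 3 ∂P := by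
  have h1 : Integrable (fun ω => 1 + (Y ω : ℂ) * Complex.I) P :=
    (integrable_const 1).add ((hY.integrable (by norm_num)).ofReal.mul_const _)
  have h2 : Integrable (fun ω => (Y ω : ℂ) ^ 2 / 2) P := by
    have := (integrable_norm_pow_of_memLp hY (n := 2) (by norm_num)).ofReal (𝕜 := ℂ)
    simpa only [Real.norm_eq_abs, sq_abs, Complex.coe_algebraMap, Complex.ofReal_pow]
      using this.div_const 2
  have h3 : Integrable (fun ω => |Y ω| ^ 3) P := integrable_norm_pow_of_memLp hY le_rfl
  have hexp : Integrable (fun ω => Complex.exp (Y ω * Complex.I)) P :=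
    Integrable.of_bound (by have := hY.1; fun_prop) 1
      (ae_of_all _ fun ω => (Complex.norm_exp_ofReal_mul_I _).le)
  have htaylor : (∫ ω, (1 + Y ω * Complex.I - Y ω ^ 2 / 2) ∂P : ℂ) =
      1 - (∫ ω, Y ω ^ 2 ∂P : ℝ) / 2 := by
    rw [integral_sub h1 h2, integral_add (integrable_const 1)
      ((hY.integrable (by norm_num)).ofReal.mul_const _), integral_mul_const, integral_div]
    simp only [← Complex.ofReal_pow, integral_complex_ofReal, hY0]
    simp
  rw [← htaylor, ← integral_sub hexp (h1.sub' h2), ← integral_const_mul]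
  exact norm_integral_le_of_norm_le (h3.const_mul 4)
    (ae_of_all _ fun ω => norm_exp_mul_I_sub_taylor_le (Y ω))

lemma norm_integral_exp_mul_I_sub_le {Y : Ω → ℝ} (hY : MemLp Y 3 P) (hY0 : ∫ ω, Y ω ∂P = 0) :
    ‖∫ ω, Complex.exp (Y ω * Complex.I) ∂P - Complex.exp (-(∫ ω, Y ω ^ 2 ∂P : ℝ) / 2)‖ ≤
      5 * ∫ ω, |Y ω| ^ 3 ∂P := by
  have hsq : √(∫ ω, Y ω ^ 2 ∂P) ^ 2 = ∫ ω, Y ω ^ 2 ∂P :=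
    Real.sq_sqrt (integral_nonneg fun _ => sq_nonneg _)
  have hexp : ‖Complex.exp (-(∫ ω, Y ω ^ 2 ∂P : ℝ) / 2) - (1 - (∫ ω, Y ω ^ 2 ∂P : ℝ) / 2)‖ ≤
      ∫ ω, |Y ω| ^ 3 ∂P := by
    have := (abs_exp_neg_sq_half_sub_le (Real.sqrt_nonneg _)).trans
      (sqrt_integral_sq_pow_three_le hY)
    rw [hsq, ← Real.norm_eq_abs, ← Complex.norm_real] at this
    simpa only [Complex.ofReal_sub, Complex.ofReal_exp, Complex.ofReal_neg, Complex.ofReal_div,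
      Complex.ofReal_one, Complex.ofReal_ofNat, neg_div] using this
  calc _ ≤ _ + _ := norm_sub_le_norm_sub_add_norm_sub _ (1 - (∫ ω, Y ω ^ 2 ∂P : ℝ) / 2 : ℂ) _
    _ ≤ 4 * ∫ ω, |Y ω| ^ 3 ∂P + ∫ ω, |Y ω| ^ 3 ∂P :=
      add_le_add (norm_integral_exp_mul_I_sub_taylor_le hY hY0) (by rwa [norm_sub_rev])
    _ = 5 * ∫ ω, |Y ω| ^ 3 ∂P := by ring

lemma norm_integral_exp_sum_sub_le {ι : Type*} [Fintype ι] {Y : ι → Ω → ℝ}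
    (hind : iIndepFun Y P) (hY : ∀ k, MemLp (Y k) 3 P) (hY0 : ∀ k, ∫ ω, Y k ω ∂P = 0) :
    ‖∫ ω, Complex.exp ((∑ k, Y k ω : ℝ) * Complex.I) ∂P -
        Complex.exp (-(∑ k, ∫ ω, Y k ω ^ 2 ∂P : ℝ) / 2)‖ ≤ 5 * ∑ k, ∫ ω, |Y k ω| ^ 3 ∂P := by
  have hprod : ∫ ω, Complex.exp ((∑ k, Y k ω : ℝ) * Complex.I) ∂P =
      ∏ k, ∫ ω, Complex.exp (Y k ω * Complex.I) ∂P := by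
    rw [← hind.integral_fun_prod_comp (f := fun _ (y : ℝ) => Complex.exp (y * Complex.I))
      (fun k => (hY k).1.aemeasurable) fun k => by fun_prop]
    simp only [Complex.ofReal_sum, Finset.sum_mul, Complex.exp_sum]
  have hexp : Complex.exp (-(∑ k, ∫ ω, Y k ω ^ 2 ∂P : ℝ) / 2) =
      ∏ k, Complex.exp (-(∫ ω, Y k ω ^ 2 ∂P : ℝ) / 2) := by
    rw [← Complex.exp_sum, Complex.ofReal_sum, ← Finset.sum_neg_distrib, Finset.sum_div]
  rw [hprod, hexp, Finset.mul_sum]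
  refine (norm_prod_sub_prod_le _ (fun k _ => ?_) fun k _ => ?_).trans
    (Finset.sum_le_sum fun k _ => norm_integral_exp_mul_I_sub_le (hY k) (hY0 k))
  · refine (norm_integral_le_of_norm_le_const (C := 1)
      (ae_of_all _ fun ω => (Complex.norm_exp_ofReal_mul_I _).le)).trans ?_
    simp
  · have : 0 ≤ ∫ ω, Y k ω ^ 2 ∂P := integral_nonneg fun _ => sq_nonneg _
    rw [Complex.norm_exp, Real.exp_le_one_iff]
    norm_cast
    linarith

end Lyapunov

section CovarianceMatrix

variable {Ω ι : Type*} [MeasurableSpace Ω] {P : Measure Ω} [IsProbabilityMeasure P]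

lemma dotProduct_covariance_mulVec [Fintype ι] {X : ι → Ω → ℝ} (hX : ∀ a, MemLp (X a) 2 P)
    (t : ι → ℝ) :
    t ⬝ᵥ (Matrix.of fun a b => cov[X a, X b; P]) *ᵥ t = Var[fun ω => ∑ a, t a * X a ω; P] := by
  rw [variance_fun_sum fun a => (hX a).const_mul (t a)]
  simp only [dotProduct, mulVec, Matrix.of_apply, Finset.mul_sum, covariance_const_mul_left,
    covariance_const_mul_right]
  exact Finset.sum_congr rfl fun a _ => Finset.sum_congr rfl fun b _ => by ring

lemma posSemidef_covariance [Finite ι] {X : ι → Ω → ℝ} (hX : ∀ a, MemLp (X a) 2 P) :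
    (Matrix.of fun a b => cov[X a, X b; P]).PosSemidef := by
  have := Fintype.ofFinite ι
  refine Matrix.PosSemidef.of_dotProduct_mulVec_nonneg ?_ fun t => ?_
  · ext a b
    simp [covariance_comm (X a)]
  · rw [star_trivial, dotProduct_covariance_mulVec hX]
    exact variance_nonneg _ _

lemma variance_const_add_sum {κ : Type*} [Fintype κ] {Y : κ → Ω → ℝ} (hind : iIndepFun Y P)
    (hY : ∀ k, MemLp (Y k) 2 P) (hY0 : ∀ k, ∫ ω, Y k ω ∂P = 0) (c : ℝ) :
    Var[fun ω => c + ∑ k, Y k ω; P] = ∑ k, ∫ ω, Y k ω ^ 2 ∂P := by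
  have hvar : Var[fun ω => ∑ k, Y k ω; P] = ∑ k, Var[Y k; P] := by
    simpa only [Finset.sum_fn] using
      IndepFun.variance_sum (fun k _ => hY k) fun i _ j _ hij => hind.indepFun hij
  rw [variance_const_add (memLp_finsetSum _ fun k _ => hY k).1, hvar]
  exact Finset.sum_congr rfl fun k _ => variance_of_integral_eq_zero (hY k).1.aemeasurable (hY0 k)

end CovarianceMatrix

section CharFun

variable {Ω ι κ : Type*} [MeasurableSpace Ω] {P : Measure Ω} [IsProbabilityMeasure P]
  [Fintype ι] [Fintype κ]

lemma integral_abs_inner_pow_three_le {E : Type*} [NormedAddCommGroup E] [InnerProductSpace ℝ E]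
    {μ : Measure Ω} [IsFiniteMeasure μ] {X : Ω → E} (hX : MemLp X 3 μ) (u : E) :
    ∫ ω, |⟪u, X ω⟫| ^ 3 ∂μ ≤ ‖u‖ ^ 3 * ∫ ω, ‖X ω‖ ^ 3 ∂μ := by
  have hu : MemLp (fun ω => ⟪u, X ω⟫) 3 μ := hX.const_inner u
  rw [← integral_const_mul]
  refine integral_mono (integrable_norm_pow_of_memLp hu le_rfl)
    ((integrable_norm_pow_of_memLp hX le_rfl).const_mul _) fun ω => ?_
  rw [← mul_pow]
  gcongr
  exact abs_real_inner_le_norm _ _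

lemma charFun_map_const_add {μ : Measure Ω} {A Y : Ω → EuclideanSpace ℝ ι} (hY : AEMeasurable Y μ)
    {m : EuclideanSpace ℝ ι} (hA : ∀ ω, A ω = m + Y ω) (u : EuclideanSpace ℝ ι) :
    charFun (μ.map A) u = Complex.exp (⟪u, m⟫ * Complex.I) *
      ∫ ω, Complex.exp (⟪u, Y ω⟫ * Complex.I) ∂μ := by
  obtain rfl : A = fun ω => m + Y ω := funext hA
  rw [charFun_apply, integral_map (by fun_prop) (by fun_prop), ← integral_const_mul]
  refine integral_congr_ae (ae_of_all _ fun ω => ?_)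
  simp only [real_inner_comm u, inner_add_right, Complex.ofReal_add, add_mul, Complex.exp_add]

lemma charFun_multivariateGaussian_covariance [DecidableEq ι] {A : Ω → EuclideanSpace ℝ ι}
    (hA : MemLp A 2 P) (m u : EuclideanSpace ℝ ι) :
    charFun (multivariateGaussian m
        (Matrix.of fun a b => cov[fun ω => A ω a, fun ω => A ω b; P])) u =
      Complex.exp (⟪u, m⟫ * Complex.I) *
        Complex.exp (-(Var[fun ω => ⟪u, A ω⟫; P] : ℝ) / 2) := by
  have hvar : (fun ω => ⟪u, A ω⟫) = fun ω => ∑ a, u a * A ω a := by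
    ext ω
    simp [PiLp.inner_apply, mul_comm]
  rw [charFun_multivariateGaussian (posSemidef_covariance hA.eval_piLp),
    dotProduct_covariance_mulVec hA.eval_piLp, hvar, ← Complex.exp_add]
  ring_nf

lemma norm_charFun_sub_charFun_multivariateGaussian_le [DecidableEq ι]
    {X : κ → Ω → EuclideanSpace ℝ ι}
    (hind : iIndepFun X P) (hX : ∀ k, MemLp (X k) 3 P) (hX0 : ∀ k, ∫ ω, X k ω ∂P = 0)
    {A : Ω → EuclideanSpace ℝ ι} {m : EuclideanSpace ℝ ι} (hA : ∀ ω, A ω = m + ∑ k, X k ω)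
    (u : EuclideanSpace ℝ ι) :
    ‖charFun (P.map A) u - charFun (multivariateGaussian m
        (Matrix.of fun a b => cov[fun ω => A ω a, fun ω => A ω b; P])) u‖ ≤
      5 * ‖u‖ ^ 3 * ∑ k, ∫ ω, ‖X k ω‖ ^ 3 ∂P := by
  have hindY : iIndepFun (fun k ω => ⟪u, X k ω⟫) P :=
    hind.comp (fun _ x => ⟪u, x⟫) fun _ => by fun_prop
  have hY : ∀ k, MemLp (fun ω => ⟪u, X k ω⟫) 3 P := fun k => (hX k).const_inner u
  have hY0 : ∀ k, ∫ ω, ⟪u, X k ω⟫ ∂P = 0 := fun k => by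
    rw [integral_inner ((hX k).integrable (by norm_num)), hX0, inner_zero_right]
  have hsum : MemLp (fun ω => ∑ k, X k ω) 2 P :=
    memLp_finsetSum _ fun k _ => (hX k).mono_exponent (by norm_num)
  have hA2 : MemLp A 2 P := by
    rw [funext hA]
    exact (memLp_const m).add hsum
  have hvar : Var[fun ω => ⟪u, A ω⟫; P] = ∑ k, ∫ ω, ⟪u, X k ω⟫ ^ 2 ∂P := by
    simp only [hA, inner_add_right, inner_sum]
    exact variance_const_add_sum hindY (fun k => (hY k).mono_exponent (by norm_num)) hY0 _
  rw [charFun_map_const_add hsum.1.aemeasurable hA, charFun_multivariateGaussian_covariance hA2,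
    hvar, ← mul_sub, norm_mul, Complex.norm_exp_ofReal_mul_I, one_mul]
  simp only [inner_sum]
  refine (norm_integral_exp_sum_sub_le hindY hY hY0).trans ?_
  rw [mul_assoc, Finset.mul_sum _ _ (‖u‖ ^ 3)]
  gcongr with k
  exact integral_abs_inner_pow_three_le (hX k) u

lemma charFun_map_sub_div (μ : Measure (EuclideanSpace ℝ ι)) (m t : EuclideanSpace ℝ ι)
    (σ : ι → ℝ) :
    charFun (μ.map fun x => WithLp.toLp 2 fun a => (x a - m a) / σ a) t =
      Complex.exp (-⟪m, WithLp.toLp 2 fun a => t a / σ a⟫ * Complex.I) *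
        charFun μ (WithLp.toLp 2 fun a => t a / σ a) := by
  rw [charFun_apply, charFun_apply, integral_map (by fun_prop) (by fun_prop),
    ← integral_const_mul]
  refine integral_congr_ae (ae_of_all _ fun x => ?_)
  have h : ⟪(WithLp.toLp 2 fun a => (x a - m a) / σ a : EuclideanSpace ℝ ι), t⟫ =
      -⟪m, WithLp.toLp 2 fun a => t a / σ a⟫ + ⟪x, WithLp.toLp 2 fun a => t a / σ a⟫ := by
    simp only [PiLp.inner_apply, ← Finset.sum_neg_distrib, ← Finset.sum_add_distrib]
    exact Finset.sum_congr rfl fun a _ => by simp; ring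
  simp only [h, Complex.ofReal_add, Complex.ofReal_neg, add_mul, Complex.exp_add]

lemma norm_charFun_map_sub_div_sub (μ ν : Measure (EuclideanSpace ℝ ι))
    (m t : EuclideanSpace ℝ ι) (σ : ι → ℝ) :
    ‖charFun (μ.map fun x => WithLp.toLp 2 fun a => (x a - m a) / σ a) t -
        charFun (ν.map fun x => WithLp.toLp 2 fun a => (x a - m a) / σ a) t‖ =
      ‖charFun μ (WithLp.toLp 2 fun a => t a / σ a) -
        charFun ν (WithLp.toLp 2 fun a => t a / σ a)‖ := by
  rw [charFun_map_sub_div, charFun_map_sub_div, ← mul_sub, norm_mul, ← Complex.ofReal_neg,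
    Complex.norm_exp_ofReal_mul_I, one_mul]

lemma norm_toLp_div_le (t : EuclideanSpace ℝ ι) {σ : ι → ℝ} {s : ℝ} (hs : 0 < s)
    (hσ : ∀ a, s ≤ σ a) : ‖(WithLp.toLp 2 fun a => t a / σ a : EuclideanSpace ℝ ι)‖ ≤ ‖t‖ / s := by
  have h : ‖t‖ / s = ‖s⁻¹ • t‖ := by
    rw [norm_smul, norm_inv, Real.norm_of_nonneg hs.le, div_eq_inv_mul]
  rw [h, EuclideanSpace.norm_eq, EuclideanSpace.norm_eq]
  gcongr with a
  rw [PiLp.smul_apply, norm_smul, norm_inv, norm_div, Real.norm_of_nonneg hs.le,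
    Real.norm_of_nonneg (hs.le.trans (hσ a)), div_eq_inv_mul]
  gcongr
  exact hσ a

end CharFun

section WeakComparison

lemma isTightMeasureSet_of_map_eval_eq {ι : Type*} [Finite ι]
    {S : Set (Measure (EuclideanSpace ℝ ι))} (ν : ι → Measure ℝ) [∀ i, IsFiniteMeasure (ν i)]
    (h : ∀ μ ∈ S, ∀ i, μ.map (fun x => x i) = ν i) : IsTightMeasureSet S := by
  have := Fintype.ofFinite ι
  refine isTightMeasureSet_of_forall_basis_tendsto (EuclideanSpace.basisFun ι ℝ) fun i => ?_
  have hν := isTightMeasureSet_iff_tendsto_measure_norm_gt.1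
    (isTightMeasureSet_singleton (μ := ν i))
  simp only [Set.mem_singleton_iff, iSup_iSup_eq_left] at hν
  refine tendsto_of_tendsto_of_tendsto_of_le_of_le tendsto_const_nhds hν (fun _ => zero_le)
    fun r => iSup₂_le fun μ hμ => ?_
  rw [← h μ hμ i, Measure.map_apply (by fun_prop) (measurableSet_lt measurable_const (by fun_prop))]
  simp

variable {E : Type*} [NormedAddCommGroup E] [InnerProductSpace ℝ E] [FiniteDimensional ℝ E]
  [MeasurableSpace E] [BorelSpace E]

lemma tendsto_integral_sub_of_tendsto_charFun_sub {μ γ : ℕ → Measure E}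
    [∀ n, IsProbabilityMeasure (μ n)] [∀ n, IsProbabilityMeasure (γ n)]
    {S : Set (Measure E)} (hS : IsTightMeasureSet S) (hγ : ∀ᶠ n in atTop, γ n ∈ S)
    (hμγ : ∀ t, Tendsto (fun n => charFun (μ n) t - charFun (γ n) t) atTop (𝓝 0)) (f : E →ᵇ ℝ) :
    Tendsto (fun n => ∫ x, f x ∂μ n - ∫ x, f x ∂γ n) atTop (𝓝 0) := by
  refine tendsto_of_subseq_tendsto fun ns hns => ?_
  let μ' : ℕ → ProbabilityMeasure E := fun n => ⟨μ n, inferInstance⟩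
  let γ' : ℕ → ProbabilityMeasure E := fun n => ⟨γ n, inferInstance⟩
  let T : Set (ProbabilityMeasure E) := {ρ | (ρ : Measure E) ∈ S}
  have hT : IsCompact (closure T) := isCompact_closure_of_isTightMeasureSet
    (hS.subset (by rintro _ ⟨ρ, hρ, rfl⟩; exact hρ))
  have hγT : ∀ᶠ n in atTop, γ' (ns n) ∈ closure T :=
    (hns.eventually hγ).mono fun n hn => subset_closure (s := T) hn
  obtain ⟨ρ, -, φ, hφ, (hγρ : Tendsto (fun n => γ' (ns (φ n))) atTop (𝓝 ρ))⟩ :=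
    hT.tendsto_subseq' hγT.frequently
  have hμρ : Tendsto (fun n => μ' (ns (φ n))) atTop (𝓝 ρ) := by
    rw [ProbabilityMeasure.tendsto_iff_tendsto_charFun] at hγρ ⊢
    intro t
    simpa [μ', γ'] using ((hμγ t).comp (hns.comp hφ.tendsto_atTop)).add (hγρ t)
  refine ⟨φ, ?_⟩
  rw [ProbabilityMeasure.tendsto_iff_forall_integral_tendsto] at hγρ hμρ
  simpa [μ', γ'] using (hμρ f).sub (hγρ f)

end WeakComparison

section GaussianMarginals

variable {ι : Type*} [Fintype ι] [DecidableEq ι]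

lemma map_sub_div_sqrt_multivariateGaussian {m : EuclideanSpace ℝ ι} {S : Matrix ι ι ℝ}
    (hS : S.PosSemidef) {a : ι} (ha : 0 < S a a) :
    (multivariateGaussian m S).map (fun x => (x a - m a) / √(S a a)) = gaussianReal 0 1 := by
  have hsub : (multivariateGaussian m S).map (fun x => x a - m a) =
      gaussianReal 0 (S a a).toNNReal := by
    rw [← sub_self (m a), ← gaussianReal_map_sub_const,
      ← (measurePreserving_eval_multivariateGaussian hS).map_eq,
      Measure.map_map (by fun_prop) (by fun_prop)]
    rfl
  have hdiv := gaussianReal_map_div_const (μ := 0) (v := (S a a).toNNReal) √(S a a)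
  rw [← hsub, Measure.map_map (by fun_prop) (by fun_prop), zero_div] at hdiv
  refine hdiv.trans (congrArg _ (NNReal.eq ?_))
  simp [Real.sq_sqrt ha.le, ha.le, ha.ne']

end GaussianMarginals

section FourthMoments

variable {Ω ι : Type*} [MeasurableSpace Ω] {P : Measure Ω}

lemma integrable_add_pow_of_mul {X Y : Ω → ℝ} {n : ℕ}
    (hXY : ∀ u v, u + v = n → Integrable (fun ω => X ω ^ u * Y ω ^ v) P) :
    Integrable (fun ω => (X ω + Y ω) ^ n) P := by
  simp only [add_pow]
  exact integrable_finsetSum _ fun m hm =>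
    (hXY m (n - m) (by grind)).mul_const _

lemma integral_add_pow_le_of_mul {X Y : Ω → ℝ} {n : ℕ} {D : ℝ}
    (hXY : ∀ u v, u + v = n → Integrable (fun ω => X ω ^ u * Y ω ^ v) P)
    (hD : ∀ u v, u + v = n → |∫ ω, X ω ^ u * Y ω ^ v ∂P| ≤ D) :
    ∫ ω, (X ω + Y ω) ^ n ∂P ≤ 2 ^ n * D := by
  have hm : ∀ m ∈ Finset.range (n + 1), m + (n - m) = n := by grind
  simp only [add_pow]
  rw [integral_finsetSum _ fun m h => (hXY m (n - m) (hm m h)).mul_const _]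
  calc ∑ m ∈ Finset.range (n + 1), ∫ ω, X ω ^ m * Y ω ^ (n - m) * n.choose m ∂P
      = ∑ m ∈ Finset.range (n + 1), (∫ ω, X ω ^ m * Y ω ^ (n - m) ∂P) * n.choose m := by
        simp only [integral_mul_const]
    _ ≤ ∑ m ∈ Finset.range (n + 1), D * n.choose m := by
        gcongr with m h
        exact (le_abs_self _).trans (hD m (n - m) (hm m h))
    _ = 2 ^ n * D := by
        rw [← Finset.mul_sum, mul_comm]
        exact_mod_cast congrArg (· * D) (congrArg Nat.cast (Nat.sum_range_choose n))

variable [Fintype ι]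

lemma norm_pow_three_le_sum_pow_four (z : EuclideanSpace ℝ ι) :
    ‖z‖ ^ 3 ≤ 1 + Fintype.card ι * ∑ a, z a ^ 4 := by
  have h34 : ‖z‖ ^ 3 ≤ 1 + ‖z‖ ^ 4 := by
    rcases le_total ‖z‖ 1 with h | h
    · exact (pow_le_one₀ (norm_nonneg _) h).trans (by simp)
    · exact (pow_le_pow_right₀ h (Nat.le_succ 3)).trans (by simp)
  have h4 : ‖z‖ ^ 4 ≤ Fintype.card ι * ∑ a, z a ^ 4 := by
    have hsq := sq_sum_le_card_mul_sum_sq (s := Finset.univ) (f := fun a => z a ^ 2)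
    simp only [← EuclideanSpace.real_norm_sq_eq, ← pow_mul, Finset.card_univ] at hsq
    exact hsq
  linarith

variable [IsProbabilityMeasure P]

lemma memLp_three_of_integrable_pow_four {Z : Ω → EuclideanSpace ℝ ι}
    (hZ : AEStronglyMeasurable Z P) (h4 : ∀ a, Integrable (fun ω => Z ω a ^ 4) P) :
    MemLp Z 3 P := by
  rw [← integrable_norm_rpow_iff hZ (by norm_num) (by norm_num)]
  simp only [ENNReal.toReal_ofNat, Real.rpow_ofNat]
  have hbound : Integrable (fun ω => 1 + Fintype.card ι * ∑ a, Z ω a ^ 4) P :=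
    (integrable_const 1).add ((integrable_finsetSum _ fun a _ => h4 a).const_mul _)
  refine hbound.mono' (by fun_prop) (ae_of_all _ fun ω => ?_)
  simpa using norm_pow_three_le_sum_pow_four (Z ω)

lemma integral_norm_pow_three_le_of_pow_four {Z : Ω → EuclideanSpace ℝ ι} {D : ℝ}
    (h4 : ∀ a, Integrable (fun ω => Z ω a ^ 4) P) (hD : ∀ a, ∫ ω, Z ω a ^ 4 ∂P ≤ D) :
    ∫ ω, ‖Z ω‖ ^ 3 ∂P ≤ 1 + Fintype.card ι * (Fintype.card ι * D) := by
  have hsum : Integrable (fun ω => Fintype.card ι * ∑ a, Z ω a ^ 4) P :=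
    (integrable_finsetSum _ fun a _ => h4 a).const_mul _
  calc ∫ ω, ‖Z ω‖ ^ 3 ∂P ≤ ∫ ω, (1 + Fintype.card ι * ∑ a, Z ω a ^ 4) ∂P :=
        integral_mono_of_nonneg (ae_of_all _ fun ω => by positivity)
          ((integrable_const 1).add hsum)
          (ae_of_all _ fun ω => norm_pow_three_le_sum_pow_four (Z ω))
    _ = 1 + Fintype.card ι * ∑ a, ∫ ω, Z ω a ^ 4 ∂P := by
        rw [integral_add (integrable_const 1) hsum, integral_const_mul,
          integral_finsetSum _ fun a _ => h4 a]
        simp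
    _ ≤ 1 + Fintype.card ι * (Fintype.card ι * D) := by
        gcongr
        simpa using Finset.sum_le_card_nsmul Finset.univ _ D fun a _ => hD a

end FourthMoments

section ConvergenceInDistribution

lemma tendstoInDistribution_comp_of_tendsto_integral_sub {F G Ω' : Type*} [TopologicalSpace F]
    [MeasurableSpace F] [BorelSpace F] [TopologicalSpace G] [MeasurableSpace G] [BorelSpace G]
    [HasOuterApproxClosed G] [MeasurableSpace Ω'] {Z : Ω' → G} {P' : Measure Ω'}
    [IsProbabilityMeasure P'] {Ω : ℕ → Type*} [∀ n, MeasurableSpace (Ω n)]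
    {P : ∀ n, Measure (Ω n)} [∀ n, IsProbabilityMeasure (P n)] {Y : ∀ n, Ω n → F}
    {γ : ℕ → Measure F} (hY : ∀ n, AEMeasurable (Y n) (P n)) (hZ : AEMeasurable Z P')
    (hYγ : ∀ f : F →ᵇ ℝ, Tendsto (fun n => ∫ ω, f (Y n ω) ∂P n - ∫ x, f x ∂γ n) atTop (𝓝 0))
    {g : F → G} (hg : Continuous g) (hγ : ∀ᶠ n in atTop, (γ n).map g = P'.map Z) :
    TendstoInDistribution (fun n ω => g (Y n ω)) atTop Z P P' := by
  have hgY : ∀ n, AEMeasurable (fun ω => g (Y n ω)) (P n) := fun n =>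
    hg.measurable.comp_aemeasurable (hY n)
  refine ⟨hgY, hZ, ProbabilityMeasure.tendsto_iff_forall_integral_tendsto.2 fun f => ?_⟩
  have hlim := (hYγ (f.compContinuous ⟨g, hg⟩)).add_const (∫ x, f x ∂P'.map Z)
  rw [zero_add] at hlim
  refine hlim.congr' (hγ.mono fun n hn => ?_)
  have hf : ∀ ρ : Measure G, AEStronglyMeasurable f ρ := fun ρ =>
    f.continuous.measurable.aestronglyMeasurable
  rw [← hn, integral_map hg.aemeasurable (hf _)]
  simp [integral_map (hgY n) (hf _)]

end ConvergenceInDistribution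

section SymmetricNoise

lemma map_neg_multivariateGaussian_zero {ι : Type*} [Fintype ι] [DecidableEq ι]
    (S : Matrix ι ι ℝ) :
    (multivariateGaussian 0 S).map (fun x => -x) = multivariateGaussian 0 S := by
  by_cases hS : S.PosSemidef
  · have : IsProbabilityMeasure ((multivariateGaussian 0 S).map fun x => -x) :=
      Measure.isProbabilityMeasure_map (by fun_prop)
    refine Measure.ext_of_charFun (funext fun t => ?_)
    have h : charFun ((multivariateGaussian 0 S).map fun x => -x) t =
        charFun (multivariateGaussian 0 S) (-t) := by
      simpa using charFun_map_smul (μ := multivariateGaussian 0 S) (-1) t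
    rw [h, charFun_multivariateGaussian hS, charFun_multivariateGaussian hS]
    simp [mulVec_neg]
  · rw [multivariateGaussian_of_not_posSemidef _ hS, Measure.map_dirac' measurable_neg, neg_zero]

variable {Ω β F : Type*} [MeasurableSpace Ω] {P : Measure Ω}

lemma identDistrib_prodMk_comp [IsFiniteMeasure P] [MeasurableSpace β] [MeasurableSpace F]
    [StandardBorelSpace F] [Nonempty F] {X : Ω → β} {Y : Ω → F} {g : F → F} (hX : Measurable X)
    (hY : Measurable Y) (hg : Measurable g)
    (hinv : ∀ᵐ ω ∂P, (condDistrib Y X P (X ω)).map g = condDistrib Y X P (X ω)) :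
    IdentDistrib (fun ω => (X ω, Y ω)) (fun ω => (X ω, g (Y ω))) P P := by
  have hG : Measurable fun z : β × F => (z.1, g z.2) := by fun_prop
  refine ⟨by fun_prop, by fun_prop, ?_⟩
  have hmap : P.map (fun ω => (X ω, g (Y ω))) =
      (P.map fun ω => (X ω, Y ω)).map fun z => (z.1, g z.2) := by
    rw [Measure.map_map hG (by fun_prop)]
    rfl
  rw [hmap, ← compProd_map_condDistrib hY.aemeasurable]
  ext s hs
  rw [Measure.map_apply hG hs, Measure.compProd_apply hs, Measure.compProd_apply (hG hs),
    lintegral_map (Kernel.measurable_kernel_prodMk_left hs) hX,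
    lintegral_map (Kernel.measurable_kernel_prodMk_left (hG hs)) hX]
  refine lintegral_congr_ae ?_
  filter_upwards [hinv] with ω hω
  nth_rw 1 [← hω]
  rw [Measure.map_apply hg (measurable_prodMk_left hs)]
  rfl

lemma memLp_of_identDistrib_prodMk_neg [NormedAddCommGroup F] [NormedSpace ℝ F]
    [MeasurableSpace F] [BorelSpace F] [SecondCountableTopology F] {X Y : Ω → F}
    (hXY : IdentDistrib (fun ω => (X ω, Y ω)) (fun ω => (X ω, -Y ω)) P P) {q : ENNReal}
    (hsum : MemLp (fun ω => X ω + Y ω) q P) : MemLp X q P := by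
  have hdiff : MemLp (fun ω => X ω + -Y ω) q P :=
    (hXY.comp (u := fun z : F × F => z.1 + z.2) (by fun_prop)).memLp_iff.1 hsum
  have hX : X = (1 / 2 : ℝ) • ((fun ω => X ω + Y ω) + fun ω => X ω + -Y ω) := by
    ext1 ω
    simp only [Pi.smul_apply, Pi.add_apply]
    module
  rw [hX]
  exact (hsum.add hdiff).const_smul _

end SymmetricNoise

section Measurability

variable {d : ℕ} (c : Client d)

lemma measurable_gradient {H : Type*} [NormedAddCommGroup H] [InnerProductSpace ℝ H]
    [CompleteSpace H] [MeasurableSpace H] [BorelSpace H] (f : H → ℝ) : Measurable (∇ f) :=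
  (InnerProductSpace.toDual ℝ H).symm.continuous.measurable.comp (measurable_fderiv ℝ f)

lemma Client.measurable_iterate (η : ℝ) (w₀ : Weights d) {β : Type*} [MeasurableSpace β]
    {n : β → ℕ → Weights d} : ∀ {i : ℕ}, (∀ j < i, Measurable fun x => n x j) →
      Measurable fun x => c.iterate η w₀ (n x) i
  | 0, _ => measurable_const
  | i + 1, hn => by
    have ih := Client.measurable_iterate η w₀ fun j hj => hn j (hj.trans i.lt_succ_self)
    exact ih.add (((hn i i.lt_succ_self).sub ((measurable_gradient _).comp ih)).const_smul η)

lemma Client.iterate_congr (η : ℝ) (w₀ : Weights d) {n n' : ℕ → Weights d} :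
    ∀ {i : ℕ}, (∀ j < i, n j = n' j) → c.iterate η w₀ n i = c.iterate η w₀ n' i
  | 0, _ => rfl
  | i + 1, h => by
    simp only [Client.iterate, h i i.lt_succ_self,
      Client.iterate_congr η w₀ fun j hj => h j (hj.trans i.lt_succ_self)]

end Measurability

namespace Round

variable {d Q : ℕ} {Ω : Type*} [MeasurableSpace Ω] {𝓡 : Round d Q Ω} {P : Measure Ω} {E : ℕ}

variable (𝓡 P E) in
/-- The centered local update `N_k + R_k` of client `k`: up to the factor `p_k η_k`, its
contribution to `A_T - M_T`. -/
noncomputable def centeredUpdate (k : Fin Q) (ω : Ω) : Weights d :=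
  𝓡.totalNoise E k ω + 𝓡.totalDev P E k ω

variable (𝓡 P E) in
/-- The centered local update of client `k` as a function of its gradient noise alone, which
transfers the independence of the noises to the updates. The noise is extended by `0` beyond the
first `E` iterations. -/
noncomputable def centeredUpdateMap (k : Fin Q) (x : Fin E → Weights d) : Weights d :=
  let n : ℕ → Weights d := fun j => if h : j < E then x ⟨j, h⟩ else 0
  ∑ i ∈ Finset.range E, n i + ∑ i ∈ Finset.range E, ((∫ ω', 𝓡.grad k i ω' ∂P) -
    ∇ (𝓡.client k).loss ((𝓡.client k).iterate (𝓡.η k) 𝓡.w₀ n i))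

variable (𝓡 P E) in
lemma measurable_centeredUpdateMap (k : Fin Q) : Measurable (𝓡.centeredUpdateMap P E k) := by
  have hn : ∀ j, Measurable fun x : Fin E → Weights d =>
      if h : j < E then x ⟨j, h⟩ else (0 : Weights d) := fun j => by
    split_ifs <;> fun_prop
  refine (Finset.measurable_sum _ fun i _ => hn i).add
    (Finset.measurable_sum _ fun i _ => measurable_const.sub ?_)
  exact (measurable_gradient _).comp (Client.measurable_iterate _ _ _ fun j _ => hn j)

lemma centeredUpdateMap_noise (k : Fin Q) (ω : Ω) :
    𝓡.centeredUpdateMap P E k (fun i => 𝓡.noise k i ω) = 𝓡.centeredUpdate P E k ω := by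
  unfold centeredUpdateMap centeredUpdate totalNoise totalDev grad weights
  refine congrArg₂ (· + ·) (Finset.sum_congr rfl fun i hi => ?_)
    (Finset.sum_congr rfl fun i hi => ?_)
  · simp [Finset.mem_range.1 hi]
  · congr 2
    refine Client.iterate_congr _ _ _ fun j hj => ?_
    simp [hj.trans (Finset.mem_range.1 hi)]

lemma update_eq_add_sum_centeredUpdate (ω : Ω) :
    𝓡.update E ω =
      -(∑ k, (𝓡.p k * 𝓡.η k) • ∑ i ∈ Finset.range E, ∫ ω', 𝓡.grad k i ω' ∂P) +
        ∑ k, (𝓡.p k * 𝓡.η k) • 𝓡.centeredUpdate P E k ω := by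
  rw [neg_add_eq_sub, ← Finset.sum_sub_distrib]
  refine Finset.sum_congr rfl fun k _ => ?_
  rw [← smul_sub, mul_smul, centeredUpdate, totalNoise, totalDev, Finset.sum_sub_distrib,
    ← Finset.smul_sum, Finset.sum_sub_distrib]
  congr 2
  abel

variable (𝓡 P E) in
lemma measurable_standardize : Measurable (𝓡.standardize P E) := by
  unfold standardize
  fun_prop

variable (𝓡 P E) in
/-- The standardized server update `s_Q(A_T)`. -/
noncomputable def standardizedUpdate (ω : Ω) : Weights d :=
  𝓡.standardize P E (𝓡.update E ω)

variable (𝓡 P E) in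
/-- The image of `𝒩(M_T, V_T)` under the standardization `s_Q`, the law to which that of
`s_Q(A_T)` is compared. -/
noncomputable def standardizedGaussian : Measure (Weights d) :=
  (multivariateGaussian (𝓡.mean P E) (𝓡.covMatrix P E)).map (𝓡.standardize P E)

instance isProbabilityMeasure_standardizedGaussian :
    IsProbabilityMeasure (𝓡.standardizedGaussian P E) :=
  Measure.isProbabilityMeasure_map (𝓡.measurable_standardize P E).aemeasurable

lemma sqrt_le_scaledMoment {C : ℝ} {k : Fin Q} {a : Fin d}
    (hdiv : C ≤ 𝓡.scaledMoment P E k a ^ 2 - 1 / (2 * (Q : ℝ)) *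
      ∑ j, (𝓡.scaledMoment P E k a - 𝓡.scaledMoment P E j a) ^ 2) :
    √C ≤ 𝓡.scaledMoment P E k a := by
  have hspread : 0 ≤ 1 / (2 * (Q : ℝ)) *
      ∑ j, (𝓡.scaledMoment P E k a - 𝓡.scaledMoment P E j a) ^ 2 := by positivity
  have hmoment : 0 ≤ 𝓡.scaledMoment P E k a :=
    mul_nonneg (by positivity) (integral_nonneg fun _ => sq_nonneg _)
  exact (Real.sqrt_le_left hmoment).2 (by linarith)

namespace IsModel

variable [IsProbabilityMeasure P]

lemma measurable_centeredUpdate (h : 𝓡.IsModel P E) (k : Fin Q) :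
    Measurable (𝓡.centeredUpdate P E k) := by
  have := (𝓡.measurable_centeredUpdateMap P E k).comp
    (measurable_pi_lambda (fun ω (i : Fin E) => 𝓡.noise k i ω)
      fun i => h.measurable_noise k i i.2)
  simpa only [Function.comp_def, centeredUpdateMap_noise] using this

lemma iIndepFun_centeredUpdate (h : 𝓡.IsModel P E) : iIndepFun (𝓡.centeredUpdate P E) P := by
  have := h.indep.comp _ fun k => 𝓡.measurable_centeredUpdateMap P E k
  simpa only [Function.comp_def, centeredUpdateMap_noise] using this

lemma identDistrib_past_noise (h : 𝓡.IsModel P E) (k : Fin Q) {i : ℕ} (hi : i < E) :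
    IdentDistrib (fun ω => ((fun j : Fin i => 𝓡.noise k j ω), 𝓡.noise k i ω))
      (fun ω => ((fun j : Fin i => 𝓡.noise k j ω), -𝓡.noise k i ω)) P P := by
  refine identDistrib_prodMk_comp (X := fun ω (j : Fin i) => 𝓡.noise k j ω)
    (measurable_pi_lambda _ fun j => h.measurable_noise k j (j.2.trans hi))
    (h.measurable_noise k i hi) measurable_neg ?_
  filter_upwards [h.condDistrib_noise k i hi] with ω hω
  rw [hω]
  exact map_neg_multivariateGaussian_zero _

-- Backwards in `i`: by symmetry of the last noise `Y`, the sum `X + Y` has the same law as `X - Y`,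
-- and `X` is the average of the two.
lemma memLp_partialNoise (h : 𝓡.IsModel P E) {k : Fin Q} {q : ENNReal}
    (hN : MemLp (𝓡.totalNoise E k) q P) {i : ℕ} (hi : i ≤ E) :
    MemLp (𝓡.totalNoise i k) q P := by
  induction hi using Nat.decreasingInduction with
  | self => exact hN
  | of_succ i hi ih =>
    have hid := (h.identDistrib_past_noise k hi).comp
      (u := fun z : (Fin i → Weights d) × Weights d => (∑ j, z.1 j, z.2)) (by fun_prop)
    refine memLp_of_identDistrib_prodMk_neg (Y := 𝓡.noise k i) ?_ ?_
    · simpa only [Function.comp_def, totalNoise, Finset.sum_range] using hid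
    · rwa [show 𝓡.totalNoise (i + 1) k = fun ω => 𝓡.totalNoise i k ω + 𝓡.noise k i ω from
        funext fun ω => Finset.sum_range_succ _ _] at ih

lemma memLp_noise (h : 𝓡.IsModel P E) {k : Fin Q} {q : ENNReal}
    (hN : MemLp (𝓡.totalNoise E k) q P) {i : ℕ} (hi : i < E) : MemLp (𝓡.noise k i) q P := by
  have hnoise : 𝓡.noise k i = 𝓡.totalNoise (i + 1) k - 𝓡.totalNoise i k := by
    ext1 ω
    simp [totalNoise, Finset.sum_range_succ]
  rw [hnoise]
  exact (h.memLp_partialNoise hN hi).sub (h.memLp_partialNoise hN hi.le)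

lemma integral_noise (h : 𝓡.IsModel P E) (k : Fin Q) {i : ℕ} (hi : i < E) :
    ∫ ω, 𝓡.noise k i ω ∂P = 0 := by
  have hid := ((h.identDistrib_past_noise k hi).comp measurable_snd).integral_eq
  simp only [Function.comp_def, integral_neg] at hid
  have := IsAddTorsionFree.of_isTorsionFree ℝ (Weights d)
  exact self_eq_neg.1 hid

lemma integral_totalNoise (h : 𝓡.IsModel P E) {k : Fin Q}
    (hN : Integrable (𝓡.totalNoise E k) P) : ∫ ω, 𝓡.totalNoise E k ω ∂P = 0 := by
  simp only [totalNoise]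
  rw [integral_finsetSum _ fun i hi => memLp_one_iff_integrable.1
    (h.memLp_noise (memLp_one_iff_integrable.2 hN) (Finset.mem_range.1 hi))]
  exact Finset.sum_eq_zero fun i hi => h.integral_noise k (Finset.mem_range.1 hi)

lemma integrable_totalDev (h : 𝓡.IsModel P E) (k : Fin Q) :
    Integrable (𝓡.totalDev P E k) P :=
  integrable_finsetSum _ fun i hi =>
    (integrable_const _).sub (h.integrable_grad k i (Finset.mem_range.1 hi))

lemma integral_totalDev (h : 𝓡.IsModel P E) (k : Fin Q) : ∫ ω, 𝓡.totalDev P E k ω ∂P = 0 := by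
  have hG : ∀ i ∈ Finset.range E, Integrable (𝓡.grad k i) P := fun i hi =>
    h.integrable_grad k i (Finset.mem_range.1 hi)
  simp only [totalDev]
  rw [integral_finsetSum _ fun i hi => (integrable_const _).sub' (hG i hi)]
  refine Finset.sum_eq_zero fun i hi => ?_
  rw [integral_sub (integrable_const _) (hG i hi)]
  simp

lemma integral_centeredUpdate (h : 𝓡.IsModel P E) {k : Fin Q}
    (hZ : Integrable (𝓡.centeredUpdate P E k) P) : ∫ ω, 𝓡.centeredUpdate P E k ω ∂P = 0 := by
  have hN : Integrable (𝓡.totalNoise E k) P := by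
    have : 𝓡.totalNoise E k = 𝓡.centeredUpdate P E k - 𝓡.totalDev P E k := by
      ext1 ω
      simp [centeredUpdate]
    rw [this]
    exact hZ.sub (h.integrable_totalDev k)
  simp only [centeredUpdate]
  rw [integral_add hN (h.integrable_totalDev k), h.integral_totalNoise hN, h.integral_totalDev,
    add_zero]

lemma update_eq_mean_add (h : 𝓡.IsModel P E) (hZ : ∀ k, Integrable (𝓡.centeredUpdate P E k) P)
    (ω : Ω) :
    𝓡.update E ω = 𝓡.mean P E + ∑ k, (𝓡.p k * 𝓡.η k) • 𝓡.centeredUpdate P E k ω := by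
  have hsum : ∀ k ∈ Finset.univ,
      Integrable (fun ω => (𝓡.p k * 𝓡.η k) • 𝓡.centeredUpdate P E k ω) P :=
    fun k _ => (hZ k).smul (𝓡.p k * 𝓡.η k)
  rw [mean, update_eq_add_sum_centeredUpdate (P := P)]
  simp_rw [update_eq_add_sum_centeredUpdate (P := P)]
  rw [integral_add (integrable_const _) (integrable_finsetSum _ hsum), integral_finsetSum _ hsum]
  simp [integral_smul, h.integral_centeredUpdate (hZ _)]

lemma memLp_update (h : 𝓡.IsModel P E) (hZ : ∀ k, MemLp (𝓡.centeredUpdate P E k) 2 P) :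
    MemLp (𝓡.update E) 2 P := by
  have hsum : MemLp (fun ω => ∑ k, (𝓡.p k * 𝓡.η k) • 𝓡.centeredUpdate P E k ω) 2 P :=
    memLp_finsetSum _ fun k _ => (hZ k).const_smul (𝓡.p k * 𝓡.η k)
  have hupdate := h.update_eq_mean_add fun k => (hZ k).integrable one_le_two
  exact ((memLp_const (𝓡.mean P E)).add hsum).ae_eq (ae_of_all _ fun ω => (hupdate ω).symm)

lemma covMatrix_diag (h : 𝓡.IsModel P E) (hZ : ∀ k, MemLp (𝓡.centeredUpdate P E k) 2 P)
    (a : Fin d) : 𝓡.covMatrix P E a a = ∑ k, 𝓡.scaledMoment P E k a := by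
  have hint : ∀ k, Integrable (𝓡.centeredUpdate P E k) P := fun k => (hZ k).integrable one_le_two
  have hupdate : ∀ ω, 𝓡.update E ω a =
      𝓡.mean P E a + ∑ k, 𝓡.p k * 𝓡.η k * 𝓡.centeredUpdate P E k ω a := fun ω => by
    simp [h.update_eq_mean_add hint ω]
  have hind : iIndepFun (fun k ω => 𝓡.p k * 𝓡.η k * 𝓡.centeredUpdate P E k ω a) P :=
    h.iIndepFun_centeredUpdate.comp (fun k x => 𝓡.p k * 𝓡.η k * x a) fun k => by fun_prop
  have hmean : ∀ k, ∫ ω, 𝓡.p k * 𝓡.η k * 𝓡.centeredUpdate P E k ω a ∂P = 0 := fun k => by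
    rw [integral_const_mul, ← eval_integral_piLp (hint k).eval_piLp,
      h.integral_centeredUpdate (hint k)]
    simp
  rw [covMatrix, Matrix.of_apply, covariance_self ((h.memLp_update hZ).eval_piLp a).1.aemeasurable,
    funext hupdate, variance_const_add_sum hind (fun k => ((hZ k).eval_piLp a).const_mul _) hmean]
  refine Finset.sum_congr rfl fun k _ => ?_
  rw [scaledMoment, ← integral_const_mul]
  simp only [centeredUpdate, PiLp.add_apply, mul_pow]

lemma mul_le_covMatrix_diag (h : 𝓡.IsModel P E) (hZ : ∀ k, MemLp (𝓡.centeredUpdate P E k) 2 P)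
    {c : ℝ} {a : Fin d} (hc : ∀ k, c ≤ 𝓡.scaledMoment P E k a) :
    Q * c ≤ 𝓡.covMatrix P E a a := by
  rw [h.covMatrix_diag hZ]
  simpa using Finset.card_nsmul_le_sum Finset.univ _ c fun k _ => hc k

lemma norm_charFun_update_sub_le (h : 𝓡.IsModel P E)
    (hZ : ∀ k, MemLp (𝓡.centeredUpdate P E k) 3 P) {B D : ℝ} (hB : ∀ k, |𝓡.p k * 𝓡.η k| ≤ B)
    (hD : ∀ k, ∫ ω, ‖𝓡.centeredUpdate P E k ω‖ ^ 3 ∂P ≤ D) (u : Weights d) :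
    ‖charFun (P.map (𝓡.update E)) u -
        charFun (multivariateGaussian (𝓡.mean P E) (𝓡.covMatrix P E)) u‖ ≤
      5 * ‖u‖ ^ 3 * (Q * (B ^ 3 * D)) := by
  have hint : ∀ k, Integrable (𝓡.centeredUpdate P E k) P := fun k => (hZ k).integrable (by norm_num)
  have hind : iIndepFun (fun k ω => (𝓡.p k * 𝓡.η k) • 𝓡.centeredUpdate P E k ω) P :=
    h.iIndepFun_centeredUpdate.comp (fun k x => (𝓡.p k * 𝓡.η k) • x) fun k => by fun_prop
  have hmean : ∀ k, ∫ ω, (𝓡.p k * 𝓡.η k) • 𝓡.centeredUpdate P E k ω ∂P = 0 := fun k => by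
    rw [integral_smul, h.integral_centeredUpdate (hint k), smul_zero]
  have hthird : ∀ k, ∫ ω, ‖(𝓡.p k * 𝓡.η k) • 𝓡.centeredUpdate P E k ω‖ ^ 3 ∂P ≤ B ^ 3 * D :=
    fun k => by
      simp only [norm_smul, mul_pow, integral_const_mul, Real.norm_eq_abs]
      have hB0 : 0 ≤ B := (abs_nonneg _).trans (hB k)
      exact mul_le_mul (pow_le_pow_left₀ (abs_nonneg _) (hB k) 3) (hD k)
        (integral_nonneg fun _ => by positivity) (pow_nonneg hB0 3)
  refine (norm_charFun_sub_charFun_multivariateGaussian_le hind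
    (fun k => (hZ k).const_smul (𝓡.p k * 𝓡.η k)) hmean (h.update_eq_mean_add hint) u).trans ?_
  gcongr
  simpa using Finset.sum_le_card_nsmul Finset.univ _ _ fun k _ => hthird k

lemma aemeasurable_standardizedUpdate (h : 𝓡.IsModel P E)
    (hZ : ∀ k, MemLp (𝓡.centeredUpdate P E k) 2 P) :
    AEMeasurable (𝓡.standardizedUpdate P E) P :=
  (𝓡.measurable_standardize P E).comp_aemeasurable (h.memLp_update hZ).1.aemeasurable

lemma norm_charFun_standardizedUpdate_sub_le (h : 𝓡.IsModel P E)
    (hZ : ∀ k, MemLp (𝓡.centeredUpdate P E k) 3 P) {B D : ℝ} (hB : ∀ k, |𝓡.p k * 𝓡.η k| ≤ B)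
    (hD : ∀ k, ∫ ω, ‖𝓡.centeredUpdate P E k ω‖ ^ 3 ∂P ≤ D) {c : ℝ} (hc : 0 < c)
    (hmoment : ∀ k a, c ≤ 𝓡.scaledMoment P E k a) (hQ : 0 < Q) (t : Weights d) :
    ‖charFun (P.map (𝓡.standardizedUpdate P E)) t - charFun (𝓡.standardizedGaussian P E) t‖ ≤
      5 * (‖t‖ / √c) ^ 3 * (B ^ 3 * D) / √Q := by
  have hZ2 : ∀ k, MemLp (𝓡.centeredUpdate P E k) 2 P :=
    fun k => (hZ k).mono_exponent (by norm_num)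
  have hsqrt : 0 < √(Q * c) := by positivity
  have hle : ∀ a, √(Q * c) ≤ √(𝓡.covMatrix P E a a) := fun a =>
    Real.sqrt_le_sqrt (h.mul_le_covMatrix_diag hZ2 fun k => hmoment k a)
  have hBD : 0 ≤ B ^ 3 * D := mul_nonneg
    (pow_nonneg ((abs_nonneg _).trans (hB ⟨0, hQ⟩)) 3)
    ((integral_nonneg fun _ => by positivity).trans (hD ⟨0, hQ⟩))
  have hmap : P.map (𝓡.standardizedUpdate P E) =
      (P.map (𝓡.update E)).map (𝓡.standardize P E) :=
    (AEMeasurable.map_map_of_aemeasurable (𝓡.measurable_standardize P E).aemeasurable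
      (h.memLp_update hZ2).1.aemeasurable).symm
  rw [hmap]
  calc _ = _ := norm_charFun_map_sub_div_sub _ _ (𝓡.mean P E) t _
    _ ≤ 5 * (‖t‖ / √(Q * c)) ^ 3 * (Q * (B ^ 3 * D)) := by
      refine (h.norm_charFun_update_sub_le hZ hB hD _).trans ?_
      gcongr
      exact norm_toLp_div_le t hsqrt hle
    _ = 5 * (‖t‖ / √c) ^ 3 * (B ^ 3 * D) / √Q := by
      have hQ' : (Q : ℝ) = √Q ^ 2 := (Real.sq_sqrt Q.cast_nonneg).symm
      have : 0 < √(Q : ℝ) := by positivity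
      rw [Real.sqrt_mul Q.cast_nonneg]
      nth_rw 2 [hQ']
      field_simp

lemma map_eval_standardizedGaussian (h : 𝓡.IsModel P E)
    (hZ : ∀ k, MemLp (𝓡.centeredUpdate P E k) 2 P) {a : Fin d} (ha : 0 < 𝓡.covMatrix P E a a) :
    (𝓡.standardizedGaussian P E).map (fun x => x a) = gaussianReal 0 1 := by
  rw [standardizedGaussian, Measure.map_map (by fun_prop) (𝓡.measurable_standardize P E)]
  exact map_sub_div_sqrt_multivariateGaussian
    (posSemidef_covariance (h.memLp_update hZ).eval_piLp) ha

lemma memLp_three_centeredUpdate (h : 𝓡.IsModel P E) {k : Fin Q}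
    (hmom : ∀ a, ∀ u v : ℕ, u + v = 4 →
      Integrable (fun ω => 𝓡.totalNoise E k ω a ^ u * 𝓡.totalDev P E k ω a ^ v) P) :
    MemLp (𝓡.centeredUpdate P E k) 3 P :=
  memLp_three_of_integrable_pow_four (h.measurable_centeredUpdate k).aestronglyMeasurable
    fun a => integrable_add_pow_of_mul (hmom a)

end IsModel

lemma integral_norm_centeredUpdate_pow_three_le [IsProbabilityMeasure P] {k : Fin Q} {D : ℝ}
    (hmom : ∀ a, ∀ u v : ℕ, u + v = 4 →
      Integrable (fun ω => 𝓡.totalNoise E k ω a ^ u * 𝓡.totalDev P E k ω a ^ v) P)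
    (hD : ∀ a, ∀ u v : ℕ, u + v = 4 →
      |∫ ω, 𝓡.totalNoise E k ω a ^ u * 𝓡.totalDev P E k ω a ^ v ∂P| ≤ D) :
    ∫ ω, ‖𝓡.centeredUpdate P E k ω‖ ^ 3 ∂P ≤ 1 + d * (d * (2 ^ 4 * D)) := by
  have hint : ∀ a, Integrable (fun ω => 𝓡.centeredUpdate P E k ω a ^ 4) P :=
    fun a => integrable_add_pow_of_mul (hmom a)
  have hle : ∀ a, ∫ ω, 𝓡.centeredUpdate P E k ω a ^ 4 ∂P ≤ 2 ^ 4 * D :=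
    fun a => integral_add_pow_le_of_mul (hmom a) (hD a)
  simpa only [Fintype.card_fin] using integral_norm_pow_three_le_of_pow_four hint hle

end Round

section ManyClients

variable {d : ℕ} {E : ℕ → ℕ} {Ω : ℕ → Type*} [∀ Q, MeasurableSpace (Ω Q)]
  {P : ∀ Q, Measure (Ω Q)} [∀ Q, IsProbabilityMeasure (P Q)] {𝓡 : ∀ Q, Round d Q (Ω Q)}

lemma tendsto_charFun_standardizedUpdate_sub (model : ∀ Q, (𝓡 Q).IsModel (P Q) (E Q))
    {B : ℝ} (hB : ∀ Q k, |(𝓡 Q).p k * (𝓡 Q).η k| ≤ B)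
    {c : ℝ} (hc : 0 < c) (hmoment : ∀ Q k a, c ≤ (𝓡 Q).scaledMoment (P Q) (E Q) k a)
    (hZ : ∀ Q k, MemLp ((𝓡 Q).centeredUpdate (P Q) (E Q) k) 3 (P Q))
    {D : ℝ} (hD : ∀ Q k, ∫ ω, ‖(𝓡 Q).centeredUpdate (P Q) (E Q) k ω‖ ^ 3 ∂P Q ≤ D)
    (t : Weights d) :
    Tendsto (fun Q => charFun ((P Q).map ((𝓡 Q).standardizedUpdate (P Q) (E Q))) t -
      charFun ((𝓡 Q).standardizedGaussian (P Q) (E Q)) t) atTop (𝓝 0) := by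
  refine squeeze_zero_norm' ((eventually_gt_atTop 0).mono fun Q hQ =>
    (model Q).norm_charFun_standardizedUpdate_sub_le (hZ Q) (hB Q) (hD Q) hc (hmoment Q) hQ t) ?_
  exact (Real.tendsto_sqrt_atTop.comp tendsto_natCast_atTop_atTop).const_div_atTop _

lemma tendsto_integral_standardizedUpdate_sub
    (hY : ∀ Q, AEMeasurable ((𝓡 Q).standardizedUpdate (P Q) (E Q)) (P Q))
    (hγ : ∀ᶠ Q in atTop, ∀ a,
      ((𝓡 Q).standardizedGaussian (P Q) (E Q)).map (fun x => x a) = gaussianReal 0 1)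
    (hYγ : ∀ t, Tendsto (fun Q => charFun ((P Q).map ((𝓡 Q).standardizedUpdate (P Q) (E Q))) t -
      charFun ((𝓡 Q).standardizedGaussian (P Q) (E Q)) t) atTop (𝓝 0))
    (f : Weights d →ᵇ ℝ) :
    Tendsto (fun Q => ∫ ω, f ((𝓡 Q).standardizedUpdate (P Q) (E Q) ω) ∂P Q -
      ∫ x, f x ∂(𝓡 Q).standardizedGaussian (P Q) (E Q)) atTop (𝓝 0) := by
  have := fun Q => Measure.isProbabilityMeasure_map (hY Q)
  have hlim := tendsto_integral_sub_of_tendsto_charFun_sub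
    (isTightMeasureSet_of_map_eval_eq (S := {ρ | ∀ a, ρ.map (fun x : Weights d => x a) = _})
      (fun _ => gaussianReal 0 1) fun _ hρ => hρ) hγ hYγ f
  refine hlim.congr fun Q => ?_
  simp [integral_map (hY Q) f.continuous.measurable.aestronglyMeasurable]

end ManyClients

end FedAvg

theorem theorem3_general {d : ℕ} {E : ℕ → ℕ} {Ω : ℕ → Type*} [∀ Q, MeasurableSpace (Ω Q)]
    {P : ∀ Q, Measure (Ω Q)} [∀ Q, IsProbabilityMeasure (P Q)]
    {𝓡 : ∀ Q, FedAvg.Round d Q (Ω Q)} (model : ∀ Q, (𝓡 Q).IsModel (P Q) (E Q))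
    {B : ℝ} (hB : ∀ Q k, |(𝓡 Q).p k * (𝓡 Q).η k| ≤ B)
    {c : ℝ} (hc : 0 < c) (hmoment : ∀ Q k a, c ≤ (𝓡 Q).scaledMoment (P Q) (E Q) k a)
    (hZ : ∀ Q k, MemLp ((𝓡 Q).centeredUpdate (P Q) (E Q) k) 3 (P Q))
    {D : ℝ} (hD : ∀ Q k, ∫ ω, ‖(𝓡 Q).centeredUpdate (P Q) (E Q) k ω‖ ^ 3 ∂P Q ≤ D) :
    (∀ Q, MemLp ((𝓡 Q).update (E Q)) 2 (P Q)) ∧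
    (∀ Q, 1 ≤ Q → ∀ a, 0 < (𝓡 Q).covMatrix (P Q) (E Q) a a) ∧
    (∀ a, TendstoInDistribution
      (fun Q ω => (𝓡 Q).standardize (P Q) (E Q) ((𝓡 Q).update (E Q) ω) a) atTop
      (id : ℝ → ℝ) P (gaussianReal 0 1)) ∧
    (∀ f : FedAvg.Weights d →ᵇ ℝ, Tendsto
      (fun Q => (∫ ω, f ((𝓡 Q).standardize (P Q) (E Q) ((𝓡 Q).update (E Q) ω)) ∂P Q) -
        ∫ x, f ((𝓡 Q).standardize (P Q) (E Q) x)
          ∂multivariateGaussian ((𝓡 Q).mean (P Q) (E Q)) ((𝓡 Q).covMatrix (P Q) (E Q)))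
      atTop (𝓝 0)) := by
  have hZ2 : ∀ Q k, MemLp ((𝓡 Q).centeredUpdate (P Q) (E Q) k) 2 (P Q) :=
    fun Q k => (hZ Q k).mono_exponent (by norm_num)
  have hupdate : ∀ Q, MemLp ((𝓡 Q).update (E Q)) 2 (P Q) := fun Q => (model Q).memLp_update (hZ2 Q)
  have hvar : ∀ Q, 1 ≤ Q → ∀ a, 0 < (𝓡 Q).covMatrix (P Q) (E Q) a a := fun Q hQ a =>
    (by positivity : 0 < Q * c).trans_le
      ((model Q).mul_le_covMatrix_diag (hZ2 Q) fun k => hmoment Q k a)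
  have hY : ∀ Q, AEMeasurable ((𝓡 Q).standardizedUpdate (P Q) (E Q)) (P Q) :=
    fun Q => (model Q).aemeasurable_standardizedUpdate (hZ2 Q)
  have hgauss : ∀ᶠ Q in atTop, ∀ a,
      ((𝓡 Q).standardizedGaussian (P Q) (E Q)).map (fun x => x a) = gaussianReal 0 1 :=
    (eventually_ge_atTop 1).mono fun Q hQ a =>
      (model Q).map_eval_standardizedGaussian (hZ2 Q) (hvar Q hQ a)
  have hjoint := FedAvg.tendsto_integral_standardizedUpdate_sub hY hgauss
    (FedAvg.tendsto_charFun_standardizedUpdate_sub model hB hc hmoment hZ hD)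
  refine ⟨hupdate, hvar, fun a => ?_, fun f => (hjoint f).congr fun Q => ?_⟩
  · refine FedAvg.tendstoInDistribution_comp_of_tendsto_integral_sub hY aemeasurable_id hjoint
      (g := fun x => x a) (by fun_prop) (hgauss.mono fun Q hQ => ?_)
    rw [hQ a, Measure.map_id]
  · rw [FedAvg.Round.standardizedGaussian,
      integral_map ((𝓡 Q).measurable_standardize _ _).aemeasurable
        f.continuous.measurable.aestronglyMeasurable]
    rfl

theorem theorem3 {d : ℕ} (E : ℕ) {Ω : ℕ → Type*} [∀ Q, MeasurableSpace (Ω Q)]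
    (P : ∀ Q, Measure (Ω Q)) [∀ Q, IsProbabilityMeasure (P Q)]
    (𝓡 : ∀ Q, FedAvg.Round d Q (Ω Q)) (model : ∀ Q, (𝓡 Q).IsModel (P Q) E)
    -- uniformly bounded effective step sizes
    (B : ℝ) (hB : ∀ Q k, |(𝓡 Q).p k * (𝓡 Q).η k| ≤ B)
    -- diagonal client covariances
    (hdiag : ∀ Q k, ∀ i < E, ∀ᵐ ω ∂P Q,
      (((𝓡 Q).client k).gradCov ((𝓡 Q).weights k i ω)).IsDiag)
    -- second moments that are not too different across clients
    (C : ℝ) (hC : 0 < C)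
    (hdiv : ∀ Q k a, C ≤ (𝓡 Q).scaledMoment (P Q) E k a ^ 2 -
      1 / (2 * (Q : ℝ)) *
        ∑ j, ((𝓡 Q).scaledMoment (P Q) E k a - (𝓡 Q).scaledMoment (P Q) E j a) ^ 2)
    -- bounded fourth-order mixed moments
    (D : ℝ)
    (hmom : ∀ Q k a, ∀ u v : ℕ, u + v = 4 →
      Integrable (fun ω => (𝓡 Q).totalNoise E k ω a ^ u * (𝓡 Q).totalDev (P Q) E k ω a ^ v) (P Q) ∧
      |∫ ω, (𝓡 Q).totalNoise E k ω a ^ u * (𝓡 Q).totalDev (P Q) E k ω a ^ v ∂P Q| ≤ D) :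
    -- the mean and the covariance matrix exist, and the variances do not vanish
    (∀ Q, MemLp ((𝓡 Q).update E) 2 (P Q)) ∧
    (∀ Q, 1 ≤ Q → ∀ a, 0 < (𝓡 Q).covMatrix (P Q) E a a) ∧
    -- every standardized coordinate converges in distribution to `𝒩(0, 1)`
    (∀ a, TendstoInDistribution
      (fun Q ω => (𝓡 Q).standardize (P Q) E ((𝓡 Q).update E ω) a) atTop
      (id : ℝ → ℝ) P (gaussianReal 0 1)) ∧
    -- jointly, the laws of `A_T` and of `𝒩(M_T, V_T)`, standardized by the same affine map,
    -- have the same weak asymptotics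
    (∀ f : FedAvg.Weights d →ᵇ ℝ, Tendsto
      (fun Q => (∫ ω, f ((𝓡 Q).standardize (P Q) E ((𝓡 Q).update E ω)) ∂P Q) -
        ∫ x, f ((𝓡 Q).standardize (P Q) E x)
          ∂multivariateGaussian ((𝓡 Q).mean (P Q) E) ((𝓡 Q).covMatrix (P Q) E))
      atTop (𝓝 0)) := by
  exact theorem3_general model hB (Real.sqrt_pos.2 hC)
    (fun Q k a => FedAvg.Round.sqrt_le_scaledMoment (hdiv Q k a))
    (fun Q k => (model Q).memLp_three_centeredUpdate fun a u v h => (hmom Q k a u v h).1)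
    fun Q k => FedAvg.Round.integral_norm_centeredUpdate_pow_three_le
      (fun a u v h => (hmom Q k a u v h).1) fun a u v h => (hmom Q k a u v h).2
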